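/- For a group $H$, a set $X\subseteq H$ and $n\in\mathbb N$ let $$C_n(X,H)=\{x_1^{g_1}x_2^{g_2}\cdots x_n^{g_n} : g_i\in H,\ x_i\in X \text{ or } x_i^{-1}\in X\},\qquad x^g=g^{-1}xg .$$ A set $Y\subseteq H$ is called $n$-separated from $X$ if $Y\cap C_n(X,H)=\emptyset$. Let $\mathcal K$ be a class of groups. A group $G$ is called $\mathcal K$-approximable if for every finite set $\Phi\subseteq G$ and every $n\in\mathbb N$ there are a group $H\in\mathcal K$ and a map $\phi:\Phi\to H$ such that $\phi(1)=1$ (if $1\in\Phi$) and the set $\phi(\Phi\setminus\{1\})$ is $n$-separated from the set of defect elements $\{\phi(g)\phi(h)\phi(gh)^{-1} : g,h,gh\in\Phi\}$. Let $Sym$ and $Alt$ be the classes of finite symmetric groups $S_m$ and finite alternating groups $A_m$ ($m\ge 1$), respectively, and let $\prod(\mathcal K)$ consist of the groups from $\mathcal K$ and all finite direct products of groups from $\mathcal K$. For $h\in S_m$ let $\|h\|=\frac1m|\{x\in\{1,\dots,m\} : h(x)\ne x\}|$ be the normalized Hamming length. A group $G$ is called sofic if there is a function $\alpha:G\to\mathbb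 R$ with $\alpha_1=0$ and $\alpha_g>0$ for $g\ne1$ such that for every finite $\Phi\subseteq G$ and every $\epsilon>0$ there are $m\ge1$ and a map $\phi:\Phi\to S_m$ with $\phi(1)=1$ (if $1\in\Phi$), $\|\phi(g)\|\ge\alpha_g$ for all $g\in\Phi$, and $\|\phi(gh)(\phi(g)\phi(h))^{-1}\|<\epsilon$ whenever $g,h,gh\in\Phi$. **Proposition.** For every group $G$ the following are equivalent: $G$ is $Sym$-approximable; $G$ is $\prod(Sym)$-approximable; $G$ is $Alt$-approximable; $G$ is $\prod(Alt)$-approximable; $G$ is sofic. -/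

import Mathlib

universe u v

namespace Approx

/-- A class of groups (living in a fixed universe), given by its membership predicate. -/
def GroupClass : Type (v + 1) := ∀ (H : Type v) [Group H], Prop

/-- `C_n(X, G)`: the products of exactly `n` conjugates (in `G`) of elements `x` such that `x` or
`x⁻¹` belongs to `X`. -/
def consequences {G : Type v} [Group G] (n : ℕ) (X : Set G) : Set G :=
  {y | ∃ x g : Fin n → G, (∀ i, x i ∈ X ∨ (x i)⁻¹ ∈ X) ∧
    y = (List.ofFn fun i => (g i)⁻¹ * x i * g i).prod}

/-- `Y` is `n`-separated from `X`. -/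
def IsSeparatedFrom {G : Type v} [Group G] (n : ℕ) (Y X : Set G) : Prop :=
  Y ∩ consequences n X = ∅

/-- The set of defect elements `φ(g) φ(h) φ(gh)⁻¹`, where `g`, `h` and `gh` all lie in `Φ`. -/
def defects {G : Type u} {H : Type v} [Group G] [Group H] (Φ : Set G) (φ : G → H) : Set H :=
  {d | ∃ g h : G, g ∈ Φ ∧ h ∈ Φ ∧ g * h ∈ Φ ∧ d = φ g * φ h * (φ (g * h))⁻¹}

/-- `G` is `K`-approximable. The map `φ` is a total function, but only its values on `Φ` matter
(a map defined on `Φ` only may be extended by `1`). -/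
def IsApproximable (K : GroupClass.{v}) (G : Type u) [Group G] : Prop :=
  ∀ (Φ : Finset G) (n : ℕ), ∃ (H : Type v) (_ : Group H) (φ : G → H),
    K H ∧ φ 1 = 1 ∧
    IsSeparatedFrom n (φ '' ((Φ : Set G) \ {1})) (defects (Φ : Set G) φ)

/-- An invariant (pseudo) length function on a group. -/
structure InvLength (H : Type v) [Group H] where
  /-- the underlying function -/
  len : H → ℝ
  nonneg : ∀ g, 0 ≤ len g
  map_one : len 1 = 0
  map_mul_le : ∀ g h, len (g * h) ≤ len g + len h
  map_conj : ∀ g h, len (h⁻¹ * g * h) = len g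

/-- A class of invariant length functions: for each group `H`, the set `L H` of those length
functions on `H` that belong to the class. -/
def LengthClass : Type (v + 1) := ∀ (H : Type v) [Group H], Set (InvLength H)

/-- `G` is `(K, L)`-approximable (metric approximation). As above, only the values of `φ` on `Φ`
matter. -/
def IsMetricApproximable (K : GroupClass.{v}) (L : LengthClass.{v}) (G : Type u) [Group G] :
    Prop :=
  ∃ α : G → ℝ, α 1 = 0 ∧ (∀ g, g ≠ 1 → 0 < α g) ∧
    ∀ (Φ : Finset G) (ε : ℝ), 0 < ε →
      ∃ (H : Type v) (_ : Group H) (φ : G → H) (l : InvLength H),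
        K H ∧ l ∈ L H ∧ φ 1 = 1 ∧
        (∀ g ∈ Φ, α g ≤ l.len (φ g)) ∧
        ∀ g h, g ∈ Φ → h ∈ Φ → g * h ∈ Φ → l.len (φ (g * h) * (φ g * φ h)⁻¹) < ε

/-- The class of finite symmetric groups `S_m`, `m ≥ 1` (up to isomorphism). -/
def symClass : GroupClass.{0} := fun H _ =>
  ∃ m : ℕ, 0 < m ∧ Nonempty (H ≃* Equiv.Perm (Fin m))

/-- The class of finite alternating groups `A_m`, `m ≥ 1` (up to isomorphism). -/
def altClass : GroupClass.{0} := fun H _ =>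
  ∃ m : ℕ, 0 < m ∧ Nonempty (H ≃* alternatingGroup (Fin m))

/-- `∏(K)`: the groups from `K` together with all finite direct products of groups from `K`
(up to isomorphism). -/
def finiteProducts (K : GroupClass.{v}) : GroupClass.{v} := fun P _ =>
  K P ∨ ∃ (k : ℕ) (H : Fin k → Type v) (_ : ∀ i, Group (H i)),
    (∀ i, K (H i)) ∧ Nonempty (P ≃* (∀ i, H i))

/-- The normalized Hamming length on `S_m`: the number of moved points divided by `m`. -/
noncomputable def hamming (m : ℕ) : InvLength (Equiv.Perm (Fin m)) where
  len h := (Finset.card {x : Fin m | h x ≠ x} : ℝ) / m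
  nonneg h := by positivity
  map_one := by simp
  map_mul_le g h := by
    rw [← add_div]
    gcongr
    have h1 := (Finset.card_le_card (Equiv.Perm.support_mul_le g h)).trans
      (Finset.card_union_le g.support h.support)
    exact_mod_cast h1
  map_conj g h := by
    have h1 := Equiv.Perm.card_support_conj (σ := h⁻¹) (τ := g)
    rw [inv_inv] at h1
    exact congrArg (fun k : ℕ => (k : ℝ) / m) h1

/-- The class of all normalized Hamming length functions, on the groups `S_m` and `A_m`
(transported along isomorphisms to the groups isomorphic to these). -/
def hammingClass : LengthClass.{0} := fun H _ =>
  {l | (∃ m : ℕ, 0 < m ∧ ∃ e : H ≃* Equiv.Perm (Fin m), ∀ h, l.len h = (hamming m).len (e h)) ∨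
    (∃ m : ℕ, 0 < m ∧ ∃ e : H ≃* alternatingGroup (Fin m),
      ∀ h, l.len h = (hamming m).len (e h : Equiv.Perm (Fin m)))}

/-- Sofic groups. -/
def IsSofic (G : Type u) [Group G] : Prop :=
  IsMetricApproximable symClass hammingClass G

end Approx

/-!
Sofic groups are approximable because the Hamming length is invariant and subadditive: a product of
`n` conjugates of defects of length less than `ε` has length less than `n * ε`. For alternating
groups, `Sₘ` is embedded into `A₂ₘ` by acting on two copies of the set.

Conversely, let `G` be approximable by products of permutation groups `Kᵢ`, `Aₘ ≤ Kᵢ ≤ Sₘ` with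
`m = mᵢ`; this covers all four classes. By passing to powers and products of the underlying sets
(`HasAlmostHom.of_moved_lt`, `HasAlmostHom.of_forall_singleton`), it is enough to find, for each
`g ≠ 1` separately, an almost homomorphism to a symmetric group whose defects are short in
comparison with the image of `g`. A factor `Kᵢ` provides one unless some defect in it moves a fixed
proportion of the number of points moved by the image of `g`.

If that happens in all factors, the image of `g` is a product of boundedly many conjugates of
defects, contrary to separation. The main ingredient is `mem_conjDiff_pow_of_card_support_le`: for
`m ≥ 15`, an even permutation whose support is at most `k` times that of `x` is a product of `O(k)`
conjugates of `x` and `x⁻¹` by even permutations. To see this, note that `x` moves a set `P` of at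
least a third of its support off itself, so that its commutator with an involution on `P` is an
involution with twice the support; and that any permutation is a product of two involutions.

The factors of small degree, and the signs in the factors of large degree, are not covered by this.
They are local maps into groups of bounded order, and
`exists_local_hom_or_uniform_expression` disposes of these all at once: either `g` is detected by an
exact local homomorphism to a finite group, which acts on itself by translation, or one and the same
expression in conjugates of defects gives the image of `g` in all of these groups. Dividing by that
expression leaves an element that is trivial in the small factors and even in the large ones.
-/

namespace Approx

/-! ### Involutions -/

section Involutions

variable {α : Type*} [DecidableEq α]

open Equiv Equiv.Perm

lemma mul_mul_self_of_commute {M : Type*} [Monoid M] {a b : M} (h : Commute a b) (ha : a * a = 1)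
    (hb : b * b = 1) : a * b * (a * b) = 1 := by
  rw [h.symm.mul_mul_mul_comm, ha, hb, one_mul]

lemma exists_eq_swap_mul_of_mul_self {σ : Perm α} (h : σ * σ = 1) {a : α} (ha : σ a ≠ a) :
    ∃ σ' : Perm α, σ = swap a (σ a) * σ' ∧ σ' * σ' = 1 ∧ Perm.Disjoint (swap a (σ a)) σ' := by
  have hσa : σ (σ a) = a := by
    have := congrArg (fun p : Perm α => p a) h
    simpa using this
  have hcomm : σ * swap a (σ a) = swap a (σ a) * σ := by
    rw [mul_swap_eq_swap_mul, hσa, swap_comm]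
  refine ⟨swap a (σ a) * σ, ?_, ?_, ?_⟩
  · rw [← mul_assoc, swap_mul_self, one_mul]
  · exact mul_mul_self_of_commute hcomm.symm (swap_mul_self _ _) h
  · intro x
    by_cases hxa : x = a
    · subst hxa
      right
      simp
    by_cases hxb : x = σ a
    · subst hxb
      right
      simp [hσa]
    left
    exact swap_apply_of_ne_of_ne hxa hxb

variable [Fintype α]

lemma cycleType_of_mul_self {σ : Perm α} (h : σ * σ = 1) :
    ∃ r, σ.cycleType = Multiset.replicate r 2 ∧ σ.support.card = 2 * r := by
  have : Fact (Nat.Prime 2) := ⟨Nat.prime_two⟩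
  have h1 := cycleType_of_pow_prime_eq_one (σ := σ) (p := 2) (by rw [pow_two, h])
  refine ⟨_, h1, ?_⟩
  rw [← sum_cycleType, h1]
  simp [mul_comm]

lemma sign_eq_one_iff_of_mul_self {σ : Perm α} (h : σ * σ = 1) :
    sign σ = 1 ↔ ∃ i, σ.support.card = 4 * i := by
  obtain ⟨r, h1, h2⟩ := cycleType_of_mul_self h
  have h3 : sign σ = (-1) ^ r := by
    rw [sign_of_cycleType, h1]
    simp [pow_add, pow_mul]
  rw [h3, h2, neg_one_pow_eq_one_iff_even (by decide)]
  constructor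
  · rintro ⟨i, rfl⟩
    exact ⟨i, by ring⟩
  · rintro ⟨i, hi⟩
    exact ⟨i, by omega⟩

/-- Nontrivial involutions with equally many moved points are conjugate by an even permutation:
a transposition `(a σ(a))` commutes with `σ`. -/
lemma exists_even_conj_of_mul_self {σ w : Perm α} (hσ : σ * σ = 1) (hw : w * w = 1)
    (hw1 : w ≠ 1) (hc : σ.support.card = w.support.card) :
    ∃ g ∈ alternatingGroup α, g * w * g⁻¹ = σ := by
  obtain ⟨r, h1, h2⟩ := cycleType_of_mul_self hσ
  obtain ⟨r', h1', h2'⟩ := cycleType_of_mul_self hw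
  have hr : r = r' := by omega
  subst hr
  obtain ⟨g, hg⟩ := isConj_iff.1 (isConj_iff_cycleType_eq.2 (h1'.trans h1.symm))
  rcases Int.units_eq_one_or (sign g) with hs | hs
  · exact ⟨g, hs, hg⟩
  obtain ⟨a, ha⟩ : ∃ a, w a ≠ a := by
    by_contra! h
    exact hw1 (Equiv.ext h)
  have hwa : w (w a) = a := by
    have := congrArg (fun p : Perm α => p a) hw
    simpa using this
  have hcomm : w * swap a (w a) = swap a (w a) * w := by
    rw [mul_swap_eq_swap_mul, hwa, swap_comm]
  refine ⟨g * swap a (w a), ?_, ?_⟩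
  · rw [mem_alternatingGroup, Perm.sign_mul, hs, sign_swap ha.symm]
    rfl
  · rw [mul_inv_rev, mul_assoc g, ← hcomm, ← hg]
    group

lemma exists_involution_subset (r : ℕ) (P : Finset α) (h : 2 * r ≤ P.card) :
    ∃ τ : Perm α, τ * τ = 1 ∧ τ.support ⊆ P ∧ τ.support.card = 2 * r := by
  induction r generalizing P with
  | zero => exact ⟨1, by simp⟩
  | succ r ih =>
    obtain ⟨a, ha, b, hb, hab⟩ := Finset.one_lt_card.1 (show 1 < P.card by omega)
    have hcard : ((P.erase a).erase b).card = P.card - 2 := by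
      rw [Finset.card_erase_of_mem (Finset.mem_erase.2 ⟨hab.symm, hb⟩),
        Finset.card_erase_of_mem ha]
      omega
    obtain ⟨τ, h1, h2, h3⟩ := ih ((P.erase a).erase b) (by omega)
    have hd : Perm.Disjoint (swap a b) τ := by
      rw [disjoint_iff_disjoint_support, support_swap hab, Finset.disjoint_left]
      intro x hx hx'
      have := h2 hx'
      simp only [Finset.mem_erase, Finset.mem_insert, Finset.mem_singleton] at this hx
      tauto
    refine ⟨swap a b * τ, ?_, ?_, ?_⟩
    · exact mul_mul_self_of_commute hd.commute (swap_mul_self a b) h1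
    · refine (support_mul_le _ _).trans ?_
      rw [support_swap hab]
      intro x hx
      simp only [Finset.sup_eq_union, Finset.mem_union, Finset.mem_insert,
        Finset.mem_singleton] at hx
      rcases hx with (rfl | rfl) | hx
      · exact ha
      · exact hb
      · exact Finset.mem_of_mem_erase (Finset.mem_of_mem_erase (h2 hx))
    · rw [hd.card_support_mul, card_support_swap hab, h3]
      ring

lemma exists_involution_mul_eq (r' : ℕ) {r : ℕ} {σ : Perm α} (h : σ * σ = 1)
    (hc : σ.support.card = 2 * r) (hr : r' ≤ r) :
    ∃ σ₁ σ₂ : Perm α, σ = σ₁ * σ₂ ∧ σ₁ * σ₁ = 1 ∧ σ₂ * σ₂ = 1 ∧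
      σ₁.support.card = 2 * r' ∧ σ₂.support.card = 2 * (r - r') ∧ σ₁.support ⊆ σ.support := by
  induction r' generalizing r σ with
  | zero => exact ⟨1, σ, by simp [h, hc]⟩
  | succ r' ih =>
    obtain ⟨a, ha⟩ : σ.support.Nonempty := by
      rw [← Finset.card_pos]; omega
    rw [mem_support] at ha
    obtain ⟨σ', h1, h2, h3⟩ := exists_eq_swap_mul_of_mul_self h ha
    have hcard : σ.support.card = 2 + σ'.support.card := by
      conv_lhs => rw [h1]
      rw [h3.card_support_mul, card_support_swap ha.symm]
    have hsub : σ'.support ⊆ σ.support := by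
      conv_rhs => rw [h1, h3.support_mul]
      exact Finset.subset_union_right
    obtain ⟨σ₁, σ₂, e, k1, k2, k3, k4, k5⟩ := ih (r := r - 1) h2 (by omega) (by omega)
    have hd : Perm.Disjoint (swap a (σ a)) σ₁ := by
      rw [disjoint_iff_disjoint_support] at h3 ⊢
      exact h3.mono_right k5
    refine ⟨swap a (σ a) * σ₁, σ₂, ?_, ?_, k2, ?_, ?_, ?_⟩
    · rw [mul_assoc, ← e, ← h1]
    · exact mul_mul_self_of_commute hd.commute (swap_mul_self _ _) k1
    · rw [hd.card_support_mul, card_support_swap ha.symm, k3]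
      ring
    · rw [k4]; omega
    · rw [hd.support_mul]
      refine Finset.union_subset ?_ (k5.trans hsub)
      conv_rhs => rw [h1, h3.support_mul]
      exact Finset.subset_union_left

/-- Every permutation is a product of two involutions supported on its support: on each cycle, the
second factor is the reflection in a chosen base point, which conjugates the cycle to its
inverse. -/
lemma exists_involutions_mul_eq (z : Perm α) :
    ∃ a b : Perm α, z = a * b ∧ a * a = 1 ∧ b * b = 1 ∧
      a.support ⊆ z.support ∧ b.support ⊆ z.support := by
  classical
  let rep : α → α := fun y => (Quotient.mk (SameCycle.setoid z) y).out
  have hrep : ∀ y, ∃ i : ℤ, (z ^ i) (rep y) = y := fun y =>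
    Quotient.exact (s := SameCycle.setoid z) (Quotient.out_eq _)
  have hrep_eq : ∀ (y y' : α) (i : ℤ), (z ^ i) y = y' → rep y' = rep y := fun y y' i h =>
    congrArg Quotient.out (Quotient.sound (s := SameCycle.setoid z) ⟨i, h⟩).symm
  choose i hi using hrep
  let f : α → α := fun y => (z ^ (-(i y))) (rep y)
  have key : ∀ (y : α) (k : ℤ), (z ^ k) (rep y) = y → f y = (z ^ (-k)) (rep y) := by
    intro y k hk
    have h1 : (z ^ (i y)) (rep y) = (z ^ k) (rep y) := (hi y).trans hk.symm
    have h2 := congrArg (z ^ (-(i y) - k)) h1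
    simp only [← Perm.mul_apply, ← zpow_add] at h2
    rw [show -(i y) - k + i y = -k by ring, show -(i y) - k + k = -(i y) by ring] at h2
    exact h2.symm
  have hrf : ∀ y, rep (f y) = rep y := by
    intro y
    have h1 : rep (f y) = rep (rep y) := hrep_eq (rep y) (f y) (-(i y)) rfl
    have h2 : rep y = rep (rep y) := hrep_eq (rep y) y (i y) (hi y)
    rw [h1, ← h2]
  have hff : ∀ y, f (f y) = y := by
    intro y
    rw [key (f y) (-(i y)) (by rw [hrf]), hrf, neg_neg, hi]
  have hfz : ∀ y, f (z y) = z⁻¹ (f y) := by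
    intro y
    have h0 : rep (z y) = rep y := hrep_eq y (z y) 1 (by simp)
    rw [key (z y) (1 + i y) (by rw [h0, zpow_add, Perm.mul_apply, hi, zpow_one]), h0, neg_add,
      zpow_add, Perm.mul_apply, zpow_neg_one]
  let b : Perm α := ⟨f, f, hff, hff⟩
  have hb : ∀ y, b y = f y := fun _ => rfl
  have hbb : b * b = 1 := Equiv.ext fun y => by simp [hb, hff]
  have hfix : ∀ y, z y = y → b y = y := by
    intro y hy
    have h1 : ∀ k : ℤ, (z ^ k) y = y := fun k => zpow_apply_eq_self_of_apply_eq_self hy k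
    have h2 : rep y = y := (z ^ (i y)).injective ((hi y).trans (h1 (i y)).symm)
    rw [hb]
    change (z ^ (-(i y))) (rep y) = y
    rw [h2, h1]
  refine ⟨z * b, b, ?_, ?_, hbb, ?_, ?_⟩
  · rw [mul_assoc, hbb, mul_one]
  · refine Equiv.ext fun y => ?_
    simp only [Perm.mul_apply, hb, hfz, hff, Perm.one_apply]
    simp
  · intro y hy
    rw [mem_support] at hy ⊢
    exact fun h => hy (by rw [Perm.mul_apply, hfix y h, h])
  · intro y hy
    rw [mem_support] at hy ⊢
    exact fun h => hy (hfix y h)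

/-- Every permutation moves a set of points, containing at least a third of its support, off
itself. -/
lemma exists_disjoint_map (x : Perm α) :
    ∃ P : Finset α, Disjoint P (P.map x.toEmbedding) ∧ x.support.card ≤ 3 * P.card := by
  obtain ⟨P, hP⟩ := (Set.toFinite {P : Finset α | Disjoint P (P.map x.toEmbedding)}).exists_maximal
    ⟨∅, by simp⟩
  refine ⟨P, hP.1, ?_⟩
  have hsub : x.support ⊆ P ∪ P.map x.toEmbedding ∪ P.map x⁻¹.toEmbedding := by
    intro r hr
    rw [mem_support] at hr
    by_contra hcon
    simp only [Finset.mem_union, not_or] at hcon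
    obtain ⟨⟨h1, h2⟩, h3⟩ := hcon
    refine h1 (hP.2 (y := insert r P) ?_ (Finset.subset_insert r P) (Finset.mem_insert_self r P))
    have hP1 : Disjoint P (P.map x.toEmbedding) := hP.1
    have h4 : x r ∉ P := fun h => h3 (Finset.mem_map.2 ⟨x r, h, by simp⟩)
    have h5 : x r ∉ insert r P := by simp [hr, h4]
    simp only [Set.mem_ofPred_eq, Finset.map_insert, Finset.disjoint_insert_left,
      Finset.disjoint_insert_right, Finset.mem_insert, not_or]
    exact ⟨h5 |> (by simpa using ·), h2, hP1⟩
  refine (Finset.card_le_card hsub).trans ?_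
  refine (Finset.card_union_le _ _).trans ?_
  have := Finset.card_union_le P (P.map x.toEmbedding)
  simp only [Finset.card_map] at this ⊢
  omega

/-- If `x` moves the support of the involution `τ` off itself, then the commutator of `x` and `τ`
is an involution consisting of `τ` and a disjoint translate of it. -/
lemma commutator_involution {x τ : Perm α} {P : Finset α}
    (hP : Disjoint P (P.map x.toEmbedding)) (hτ : τ * τ = 1) (hs : τ.support ⊆ P) :
    (x * τ * x⁻¹ * τ⁻¹) * (x * τ * x⁻¹ * τ⁻¹) = 1 ∧
      (x * τ * x⁻¹ * τ⁻¹).support.card = 2 * τ.support.card := by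
  have hd : Perm.Disjoint (x * τ * x⁻¹) τ⁻¹ := by
    rw [disjoint_iff_disjoint_support, support_inv, support_conj]
    exact (hP.mono hs (Finset.map_subset_map.2 hs)).symm
  constructor
  · have h1 : x * τ * x⁻¹ * (x * τ * x⁻¹) = 1 := by
      rw [show x * τ * x⁻¹ * (x * τ * x⁻¹) = x * (τ * τ) * x⁻¹ by group, hτ]
      group
    have h2 : τ⁻¹ * τ⁻¹ = 1 := by rw [← mul_inv_rev, hτ, inv_one]
    rw [mul_assoc, ← mul_assoc τ⁻¹, ← hd.commute.eq, mul_assoc _ τ⁻¹ τ⁻¹, h2, mul_one, h1]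
  · rw [hd.card_support_mul, support_inv, card_support_conj]
    ring

end Involutions

/-! ### Quotients of conjugates -/

section ConjDiff

open scoped Pointwise

variable {H : Type*} [Group H]

/-- The set of all products of a conjugate of `x` and a conjugate of `x⁻¹`, the conjugating elements
being taken from the subgroup `A`. It contains `1`, and every element of its powers uses the
same fixed pattern of signs, so that such expressions can be combined across the factors of a
direct product. -/
def conjDiff (A : Subgroup H) (x : H) : Set H :=
  {y | ∃ g ∈ A, ∃ h ∈ A, y = g * x * g⁻¹ * (h * x * h⁻¹)⁻¹}

lemma one_mem_conjDiff (A : Subgroup H) (x : H) : 1 ∈ conjDiff A x :=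
  ⟨1, A.one_mem, 1, A.one_mem, by group⟩

lemma conjDiff_pow_mono (A : Subgroup H) (x : H) {m n : ℕ} (h : m ≤ n) {y : H}
    (hy : y ∈ conjDiff A x ^ m) : y ∈ conjDiff A x ^ n :=
  Set.pow_subset_pow_right (one_mem_conjDiff A x) h hy

lemma conj_mem_conjDiff_pow {A : Subgroup H} {x y k : H} (hk : k ∈ A) {n : ℕ}
    (hy : y ∈ conjDiff A x ^ n) : k * y * k⁻¹ ∈ conjDiff A x ^ n := by
  induction n generalizing y with
  | zero =>
    rw [pow_zero, Set.mem_one] at hy ⊢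
    rw [hy]
    group
  | succ n ih =>
    rw [pow_succ, Set.mem_mul] at hy ⊢
    obtain ⟨a, ha, b, ⟨g, hg, h, hh, rfl⟩, rfl⟩ := hy
    refine ⟨_, ih ha, k * (g * x * g⁻¹ * (h * x * h⁻¹)⁻¹) * k⁻¹,
      ⟨k * g, A.mul_mem hk hg, k * h, A.mul_mem hk hh, ?_⟩, ?_⟩ <;> group

lemma inv_mem_conjDiff_pow {A : Subgroup H} {x y : H} {n : ℕ}
    (hy : y ∈ conjDiff A x ^ n) : y⁻¹ ∈ conjDiff A x ^ n := by
  have h1 : (conjDiff A x)⁻¹ = conjDiff A x := by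
    ext y
    rw [Set.mem_inv]
    constructor
    · rintro ⟨g, hg, h, hh, e⟩
      exact ⟨h, hh, g, hg, by rw [← inv_inv y, e]; group⟩
    · rintro ⟨g, hg, h, hh, e⟩
      exact ⟨h, hh, g, hg, by rw [e]; group⟩
  rw [← Set.mem_inv, ← inv_pow, h1]
  exact hy

lemma commutator_mem_conjDiff {A : Subgroup H} {x τ : H} (hτ : τ ∈ A) :
    x * τ * x⁻¹ * τ⁻¹ ∈ conjDiff A x :=
  ⟨1, A.one_mem, τ, hτ, by group⟩

lemma mul_mem_conjDiff_pow {A : Subgroup H} {x y z : H} {m n : ℕ} (hy : y ∈ conjDiff A x ^ m)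
    (hz : z ∈ conjDiff A x ^ n) : y * z ∈ conjDiff A x ^ (m + n) := by
  rw [pow_add]
  exact Set.mul_mem_mul hy hz

end ConjDiff

/-! ### Even permutations as products of boundedly many conjugates -/

section Covering

open scoped Pointwise
open Equiv Equiv.Perm

variable {α : Type*} [DecidableEq α]

lemma swap_mul_swap_commutator {p q a b : α} (hpq : p ≠ q) (hpa : p ≠ a) (hpb : p ≠ b)
    (hqa : q ≠ a) (hqb : q ≠ b) (hab : a ≠ b) :
    (swap q b * swap a p) * (swap p b * swap q a)⁻¹ = swap p q * swap a b := by
  ext t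
  simp only [mul_inv_rev, swap_inv, Perm.mul_apply, swap_apply_def]
  split_ifs <;> simp_all

variable [Fintype α]

/-- A nontrivial permutation `x` yields an involution which is a product of at most two elements of
`conjDiff`, and whose support has size comparable to that of `x`. If `x` moves few points, then a
commutator of `x` with a three-cycle is a three-cycle, and a commutator of this with a double
transposition is a double transposition. The bound `6 * J ≤ w.support.card + 2` ensures that a third
of the support of `w` contains at least `2 * J` points; it holds with `J = 1` for a double
transposition. -/
lemma exists_involution_mem_conjDiff (hα : 15 ≤ Fintype.card α) {x : Perm α} (hx : x ≠ 1) :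
    ∃ J : ℕ, 1 ≤ J ∧ x.support.card ≤ 24 * J ∧
      ∃ w ∈ conjDiff (alternatingGroup α) x ^ 2, w * w = 1 ∧ 6 * J ≤ w.support.card + 2 := by
  obtain ⟨P, hP, hc⟩ := exists_disjoint_map x
  by_cases h4 : 4 ≤ P.card
  · obtain ⟨τ, h1, h2, h3⟩ := exists_involution_subset (2 * (P.card / 4)) P (by omega)
    obtain ⟨k1, k2⟩ := commutator_involution hP h1 h2
    refine ⟨P.card / 4, by omega, by omega, x * τ * x⁻¹ * τ⁻¹, ?_, k1, by omega⟩
    refine conjDiff_pow_mono _ _ (m := 1) (by norm_num) ?_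
    rw [pow_one]
    exact commutator_mem_conjDiff ((sign_eq_one_iff_of_mul_self h1).2 ⟨P.card / 4, by omega⟩)
  · obtain ⟨p, hp⟩ : ∃ p, x p ≠ p := by
      by_contra! h
      exact hx (Equiv.ext h)
    have hcc : 1 < (x.support)ᶜ.card := by
      rw [Finset.card_compl]
      omega
    obtain ⟨a, ha, b, hb, hab⟩ := Finset.one_lt_card.1 hcc
    rw [Finset.mem_compl, notMem_support] at ha hb
    have hpa : p ≠ a := by rintro rfl; exact hp ha
    have hpb : p ≠ b := by rintro rfl; exact hp hb
    have hqa : x p ≠ a := fun h => hpa (x.injective (h.trans ha.symm))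
    have hqb : x p ≠ b := fun h => hpb (x.injective (h.trans hb.symm))
    have hy : swap (x p) a * swap p a ∈ conjDiff (alternatingGroup α) x := by
      have h1 : swap p a * swap a b ∈ alternatingGroup α := by
        rw [mem_alternatingGroup, Perm.sign_mul, sign_swap hpa, sign_swap hab]
        rfl
      have h2 := commutator_mem_conjDiff (x := x) h1
      have h3 : x * (swap p a * swap a b) * x⁻¹ = swap (x p) a * swap a b := by
        rw [← mul_assoc x, mul_swap_eq_swap_mul x, mul_assoc _ x, mul_swap_eq_swap_mul x, ha, hb]
        group
      rw [h3, mul_inv_rev, swap_inv, swap_inv, mul_assoc, ← mul_assoc (swap a b) (swap a b),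
        swap_mul_self, one_mul] at h2
      exact h2
    set y := swap (x p) a * swap p a with hydef
    have hyp : y p = x p := by simp [hydef]
    have hyq : y (x p) = a := by
      rw [hydef, Perm.mul_apply, swap_apply_of_ne_of_ne hp hqa, swap_apply_left]
    have hya : y a = p := by
      rw [hydef, Perm.mul_apply, swap_apply_right, swap_apply_of_ne_of_ne hp.symm hpa]
    have hyb : y b = b := by
      rw [hydef, Perm.mul_apply, swap_apply_of_ne_of_ne hpb.symm hab.symm,
        swap_apply_of_ne_of_ne hqb.symm hab.symm]
    have hτ : swap p b * swap (x p) a ∈ alternatingGroup α := by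
      rw [mem_alternatingGroup, Perm.sign_mul, sign_swap hpb, sign_swap hqa]
      rfl
    have hw : y * (swap p b * swap (x p) a) * y⁻¹ * (swap p b * swap (x p) a)⁻¹ =
        swap p (x p) * swap a b := by
      rw [← swap_mul_swap_commutator hp.symm hpa hpb hqa hqb hab]
      congr 1
      rw [← mul_assoc y, mul_swap_eq_swap_mul y, mul_assoc _ y, mul_swap_eq_swap_mul y, hyp, hyq,
        hya, hyb]
      group
    have hd : Perm.Disjoint (swap p (x p)) (swap a b) := by
      rw [disjoint_iff_disjoint_support, support_swap hp.symm, support_swap hab]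
      simp [hpa.symm, hpb.symm, hqa.symm, hqb.symm]
    refine ⟨1, le_rfl, by omega, swap p (x p) * swap a b, ?_, ?_, ?_⟩
    · rw [← hw, show 2 = 1 + 1 from rfl, mul_assoc y, mul_assoc y]
      refine mul_mem_conjDiff_pow (by rwa [pow_one]) ?_
      exact conj_mem_conjDiff_pow hτ (inv_mem_conjDiff_pow (by rwa [pow_one]))
    · exact mul_mul_self_of_commute hd.commute (swap_mul_self _ _) (swap_mul_self _ _)
    · rw [hd.card_support_mul, card_support_swap hp.symm, card_support_swap hab]

/-- All even involutions whose support is not much larger than that of `x` are products of four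
elements of `conjDiff`. -/
lemma involution_mem_conjDiff (hα : 15 ≤ Fintype.card α) {x : Perm α} (hx : x ≠ 1) :
    ∃ J : ℕ, 1 ≤ J ∧ x.support.card ≤ 24 * J ∧
      ∀ (σ : Perm α) (i : ℕ), σ * σ = 1 → σ.support.card = 4 * i → i ≤ J →
        σ ∈ conjDiff (alternatingGroup α) x ^ 4 := by
  obtain ⟨J, hJ, hxJ, w, hw, hww, hwJ⟩ := exists_involution_mem_conjDiff hα hx
  refine ⟨J, hJ, hxJ, fun σ i hσ hσi hi => ?_⟩
  rcases Nat.eq_zero_or_pos i with rfl | hi0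
  · have : σ = 1 := by
      rw [← support_eq_empty_iff, ← Finset.card_eq_zero, hσi]
    rw [this]
    exact conjDiff_pow_mono _ _ (m := 0) (by norm_num) (by simp)
  obtain ⟨P, hP, hc⟩ := exists_disjoint_map w
  obtain ⟨τ, h1, h2, h3⟩ := exists_involution_subset i P (by omega)
  obtain ⟨k1, k2⟩ := commutator_involution hP h1 h2
  have hw1 : w ≠ 1 := by
    rintro rfl
    simp at hwJ
    omega
  have hinv : w⁻¹ = w := inv_eq_of_mul_eq_one_left hww
  -- `τ` may be odd, but an even permutation conjugates the involution `w` in the same way.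
  obtain ⟨g, hg, hgw⟩ := exists_even_conj_of_mul_self (σ := τ * w * τ⁻¹) (w := w)
    (by rw [show τ * w * τ⁻¹ * (τ * w * τ⁻¹) = τ * (w * w) * τ⁻¹ by group, hww]; group) hww hw1
    card_support_conj
  have hmem : w * τ * w⁻¹ * τ⁻¹ ∈ conjDiff (alternatingGroup α) x ^ 4 := by
    rw [show w * τ * w⁻¹ * τ⁻¹ = w * (τ * w⁻¹ * τ⁻¹) by group, hinv, ← hgw,
      show 4 = 2 + 2 from rfl]
    exact mul_mem_conjDiff_pow hw (conj_mem_conjDiff_pow hg hw)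
  have hne : w * τ * w⁻¹ * τ⁻¹ ≠ 1 := by
    intro h
    rw [h, support_one, Finset.card_empty] at k2
    omega
  obtain ⟨g', hg', rfl⟩ := exists_even_conj_of_mul_self hσ k1 hne (by omega)
  exact conj_mem_conjDiff_pow hg' hmem

/-- **Bounded covering.** An even permutation `z` whose support is at most `k` times as large as
that of `x` is a product of a bounded number (depending on `k` only) of conjugates of `x` and
`x⁻¹` under the alternating group. -/
theorem mem_conjDiff_pow_of_card_support_le (hα : 15 ≤ Fintype.card α) (k : ℕ) {x z : Perm α}
    (hz : z ∈ alternatingGroup α) (hk : z.support.card ≤ k * x.support.card) :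
    z ∈ conjDiff (alternatingGroup α) x ^ (48 * k + 12) := by
  by_cases hx : x = 1
  · have : z = 1 := by
      rw [← support_eq_empty_iff, ← Finset.card_eq_zero]
      simpa [hx] using hk
    rw [this]
    exact conjDiff_pow_mono _ _ (m := 0) (by norm_num) (by simp)
  obtain ⟨J, hJ, hxJ, hinv⟩ := involution_mem_conjDiff hα hx
  have hsplit : ∀ (t R : ℕ) (σ : Perm α), σ * σ = 1 → σ.support.card = 4 * R → R ≤ t * J →
      σ ∈ conjDiff (alternatingGroup α) x ^ (4 * t) := by
    intro t
    induction t with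
    | zero =>
      intro R σ _ hc hR
      have : σ = 1 := by
        rw [← support_eq_empty_iff, ← Finset.card_eq_zero, hc]
        omega
      simp [this]
    | succ t ih =>
      intro R σ hσ hc hR
      obtain ⟨σ₁, σ₂, rfl, h1, h2, h3, h4, -⟩ :=
        exists_involution_mul_eq (2 * min R J) (r := 2 * R) hσ (by omega) (by omega)
      rw [add_mul, one_mul] at hR
      rw [mul_add, mul_one, add_comm]
      exact mul_mem_conjDiff_pow (hinv σ₁ (min R J) h1 (by omega) (by omega))
        (ih (R - min R J) σ₂ h2 (by omega) (by omega))
  -- With two points outside the support at hand, both involutions can be made even.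
  have hmain : ∀ z ∈ alternatingGroup α, z.support.card ≤ k * x.support.card →
      z.support.card + 2 ≤ Fintype.card α →
      z ∈ conjDiff (alternatingGroup α) x ^ (48 * k + 8) := by
    intro z hz hk hc
    have hbound : ∀ a : Perm α, a * a = 1 → a ∈ alternatingGroup α →
        a.support.card ≤ z.support.card + 2 →
        a ∈ conjDiff (alternatingGroup α) x ^ (4 * (6 * k + 1)) := by
      intro a ha has hac
      obtain ⟨i, hi⟩ := (sign_eq_one_iff_of_mul_self ha).1 has
      refine hsplit _ i a ha hi ?_
      have : k * x.support.card ≤ k * (24 * J) := Nat.mul_le_mul_left k hxJ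
      nlinarith
    obtain ⟨a, b, rfl, ha, hb, has, hbs⟩ := exists_involutions_mul_eq z
    have hsign : sign a = sign b := by
      rw [mem_alternatingGroup, Perm.sign_mul] at hz
      rw [eq_inv_of_mul_eq_one_left hz, Int.units_inv_eq_self]
    rw [show 48 * k + 8 = 4 * (6 * k + 1) + 4 * (6 * k + 1) by ring]
    rcases Int.units_eq_one_or (sign a) with hs | hs
    · refine mul_mem_conjDiff_pow (hbound a ha hs ?_) (hbound b hb (hsign.symm.trans hs) ?_)
      · exact (Finset.card_le_card has).trans (Nat.le_add_right _ _)
      · exact (Finset.card_le_card hbs).trans (Nat.le_add_right _ _)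
    · obtain ⟨c, hc1, d, hd1, hcd⟩ := Finset.one_lt_card.1
        (show 1 < ((a * b).support)ᶜ.card by rw [Finset.card_compl]; omega)
      have hdis : ∀ e : Perm α, e.support ⊆ (a * b).support → Perm.Disjoint e (swap c d) := by
        intro e he
        rw [disjoint_iff_disjoint_support, support_swap hcd, Finset.disjoint_right]
        intro t ht hte
        rw [Finset.mem_insert, Finset.mem_singleton] at ht
        rcases ht with rfl | rfl
        · exact Finset.mem_compl.1 hc1 (he hte)
        · exact Finset.mem_compl.1 hd1 (he hte)
      have hev : ∀ e : Perm α, sign e = -1 → e * swap c d ∈ alternatingGroup α := by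
        intro e he
        rw [mem_alternatingGroup, Perm.sign_mul, he, sign_swap hcd]
        rfl
      have hcard : ∀ e : Perm α, e.support ⊆ (a * b).support →
          (e * swap c d).support.card ≤ (a * b).support.card + 2 := by
        intro e he
        rw [(hdis e he).card_support_mul, card_support_swap hcd]
        exact Nat.add_le_add_right (Finset.card_le_card he) 2
      have e1 : a * b = (a * swap c d) * (b * swap c d) := by
        rw [(hdis b hbs).commute.eq, mul_assoc, ← mul_assoc (swap c d), swap_mul_self, one_mul]
      nth_rw 1 [e1]
      exact mul_mem_conjDiff_pow
        (hbound _ (mul_mul_self_of_commute (hdis a has).commute ha (swap_mul_self _ _))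
          (hev a hs) (hcard a has))
        (hbound _ (mul_mul_self_of_commute (hdis b hbs).commute hb (swap_mul_self _ _))
          (hev b (hsign.symm.trans hs)) (hcard b hbs))
  by_cases hc : z.support.card + 2 ≤ Fintype.card α
  · exact conjDiff_pow_mono _ _ (by omega) (hmain z hz hk hc)
  -- Otherwise a double transposition is split off first, so that two points become fixed.
  obtain ⟨P, hP, hPc⟩ := exists_disjoint_map z
  obtain ⟨r, hr, s, hs, hrs⟩ := Finset.one_lt_card.1 (show 1 < P.card by omega)
  have hPz : ∀ r ∈ P, ∀ s ∈ P, z s ≠ r := fun r hr s hs h =>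
    Finset.disjoint_left.1 hP hr (Finset.mem_map.2 ⟨s, hs, h⟩)
  have hzrs : z r ≠ z s := fun h => hrs (z.injective h)
  have hrr := hPz r hr r hr
  have hss := hPz s hs s hs
  have hrs' := hPz r hr s hs
  have hsr' := hPz s hs r hr
  have hd : Perm.Disjoint (swap r (z r)) (swap s (z s)) := by
    rw [disjoint_iff_disjoint_support, support_swap hrr.symm, support_swap hss.symm]
    simp [hrs.symm, hzrs.symm, hrs', hsr'.symm]
  set t := swap r (z r) * swap s (z s) with ht
  have htt : t * t = 1 := mul_mul_self_of_commute hd.commute (swap_mul_self _ _) (swap_mul_self _ _)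
  have htc : t.support.card = 4 * 1 := by
    rw [ht, hd.card_support_mul, card_support_swap hrr.symm, card_support_swap hss.symm]
  have htr : t (z r) = r := by
    rw [ht, Perm.mul_apply, swap_apply_of_ne_of_ne hsr' hzrs, swap_apply_right]
  have hts : t (z s) = s := by
    rw [ht, Perm.mul_apply, swap_apply_right, swap_apply_of_ne_of_ne hrs.symm hsr'.symm]
  have hsupp : (t * z).support ⊆ (Finset.univ.erase r).erase s := by
    intro i hi
    rw [mem_support, Perm.mul_apply] at hi
    simp only [Finset.mem_erase, Finset.mem_univ, and_true]
    constructor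
    · rintro rfl; exact hi hts
    · rintro rfl; exact hi htr
  have hcard : (t * z).support.card + 2 ≤ Fintype.card α := by
    have h1 := Finset.card_le_card hsupp
    rw [Finset.card_erase_of_mem (by simp [hrs.symm]), Finset.card_erase_of_mem (by simp),
      Finset.card_univ] at h1
    omega
  have hta : t ∈ alternatingGroup α := (sign_eq_one_iff_of_mul_self htt).2 ⟨1, htc⟩
  rw [show z = t * (t * z) by rw [← mul_assoc, htt, one_mul],
    show 48 * k + 12 = 4 + (48 * k + 8) by ring]
  exact mul_mem_conjDiff_pow (hinv t 1 htt htc hJ)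
    (hmain _ ((alternatingGroup α).mul_mem hta hz) (by omega) hcard)

end Covering

/-! ### The normalized Hamming length -/

section HammingLength

open Equiv Equiv.Perm

variable {α β : Type*} [Fintype α] [DecidableEq α] [Fintype β] [DecidableEq β]

/-- The normalized Hamming length of a permutation of a finite type: the proportion of moved
points. -/
noncomputable def moved (σ : Perm α) : ℝ := (σ.support.card : ℝ) / Fintype.card α

lemma hamming_len_eq_moved (m : ℕ) (σ : Perm (Fin m)) : (hamming m).len σ = moved σ := by
  simp only [hamming, moved, Fintype.card_fin]
  rfl

lemma moved_nonneg (σ : Perm α) : 0 ≤ moved σ := by unfold moved; positivity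

lemma moved_one : moved (1 : Perm α) = 0 := by simp [moved]

lemma moved_le_one (σ : Perm α) : moved σ ≤ 1 := by
  unfold moved
  refine div_le_one_of_le₀ ?_ (by positivity)
  exact_mod_cast σ.support.card_le_univ

lemma moved_mul_le (σ τ : Perm α) : moved (σ * τ) ≤ moved σ + moved τ := by
  unfold moved
  rw [← add_div]
  gcongr
  exact_mod_cast (Finset.card_le_card (support_mul_le σ τ)).trans (Finset.card_union_le _ _)

lemma moved_inv (σ : Perm α) : moved σ⁻¹ = moved σ := by simp [moved]

lemma moved_conj (g σ : Perm α) : moved (g⁻¹ * σ * g) = moved σ := by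
  have := card_support_conj (σ := g⁻¹) (τ := σ)
  rw [inv_inv] at this
  rw [moved, moved, this]

lemma one_sub_moved [Nonempty α] (σ : Perm α) :
    1 - moved σ = ((Finset.univ.filter fun x => σ x = x).card : ℝ) / Fintype.card α := by
  have h1 := Finset.card_filter_add_card_filter_not (s := (Finset.univ : Finset α))
    (fun x => σ x = x)
  have h2 : σ.support = Finset.univ.filter fun x => ¬ σ x = x := by ext; simp
  have h3 : (Fintype.card α : ℝ) ≠ 0 := by simp
  rw [moved, h2, eq_div_iff h3, sub_mul, div_mul_cancel₀ _ h3, one_mul, sub_eq_iff_eq_add]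
  rw [Finset.card_univ] at h1
  exact_mod_cast h1.symm

lemma moved_of_fixed_iff {σ : Perm α} {τ : Perm β} (e : α ≃ β)
    (h : ∀ x, σ x = x ↔ τ (e x) = e x) : moved σ = moved τ := by
  have h1 : (σ.support.card) = τ.support.card :=
    Finset.card_equiv e fun x => by simp [h]
  rw [moved, moved, h1, Fintype.card_congr e]

lemma moved_sumCongr [Nonempty α] (σ : Perm α) : moved (Equiv.sumCongr σ σ) = moved σ := by
  have h1 : (Finset.univ.filter fun x => (Equiv.sumCongr σ σ : Perm (α ⊕ α)) x = x) =
      (Finset.univ.filter fun x => σ x = x).disjSum (Finset.univ.filter fun x => σ x = x) := by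
    ext x
    rcases x with x | x <;> simp
  have h2 : (Fintype.card α : ℝ) ≠ 0 := by simp
  have h3 : 1 - moved (Equiv.sumCongr σ σ) = 1 - moved σ := by
    rw [one_sub_moved, one_sub_moved, h1, Finset.card_disjSum, Fintype.card_sum]
    push_cast
    field_simp
  linarith

lemma one_sub_moved_prodCongr [Nonempty α] [Nonempty β] (σ : Perm α) (τ : Perm β) :
    1 - moved (Equiv.prodCongr σ τ) = (1 - moved σ) * (1 - moved τ) := by
  have h1 : (Finset.univ.filter fun x => (Equiv.prodCongr σ τ : Perm (α × β)) x = x) =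
      (Finset.univ.filter fun x => σ x = x) ×ˢ (Finset.univ.filter fun x => τ x = x) := by
    ext ⟨x, y⟩
    simp
  rw [one_sub_moved, one_sub_moved, one_sub_moved, h1, Finset.card_product, Fintype.card_prod]
  push_cast
  rw [div_mul_div_comm]

lemma one_sub_moved_piCongrRight [Nonempty α] (k : ℕ) (σ : Perm α) :
    1 - moved (Equiv.piCongrRight fun _ : Fin k => σ) = (1 - moved σ) ^ k := by
  have h1 : (Finset.univ.filter fun x : Fin k → α =>
      (Equiv.piCongrRight fun _ : Fin k => σ) x = x) =
      Fintype.piFinset fun _ => Finset.univ.filter fun x => σ x = x := by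
    ext x
    simp [funext_iff]
  rw [one_sub_moved, one_sub_moved, h1, Fintype.card_piFinset_const, Fintype.card_pi_const]
  push_cast
  rw [div_pow]

end HammingLength

/-! ### Almost homomorphisms to finite symmetric groups -/

section AlmostHom

open Equiv Equiv.Perm

variable {G : Type u} [Group G]

/-- There is a map from `G` to a finite symmetric group which is multiplicative on `Φ` up to `ε` and
moves at least half of the points for each element of `T`. -/
def HasAlmostHom (Φ : Finset G) (ε : ℝ) (T : Finset G) : Prop :=
  ∃ (α : Type) (_ : Fintype α) (_ : DecidableEq α) (_ : Nonempty α) (φ : G → Perm α),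
    φ 1 = 1 ∧ (∀ g ∈ T, 1 / 2 ≤ moved (φ g)) ∧
    ∀ g h, g ∈ Φ → h ∈ Φ → g * h ∈ Φ → moved (φ (g * h) * (φ g * φ h)⁻¹) < ε

/-- Almost homomorphisms separating the elements of `T` one at a time are combined by letting the
product of the symmetric groups act on the product of the underlying sets. -/
lemma HasAlmostHom.of_forall_singleton {Φ T : Finset G}
    (h : ∀ g ∈ T, ∀ ε : ℝ, 0 < ε → HasAlmostHom Φ ε {g}) {ε : ℝ} (hε : 0 < ε) :
    HasAlmostHom Φ ε T := by
  classical
  induction T using Finset.induction_on generalizing ε with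
  | empty =>
    exact ⟨Unit, inferInstance, inferInstance, inferInstance, fun _ => 1, rfl, by simp,
      fun _ _ _ _ _ => by simpa [moved_one] using hε⟩
  | insert g T _ ih =>
    obtain ⟨α, _, _, _, φ, h1, h2, h3⟩ :=
      ih (fun g hg => h g (Finset.mem_insert_of_mem hg)) (half_pos hε)
    obtain ⟨β, _, _, _, ψ, k1, k2, k3⟩ := h g (Finset.mem_insert_self g T) _ (half_pos hε)
    refine ⟨α × β, inferInstance, inferInstance, inferInstance,
      fun x => Equiv.prodCongr (φ x) (ψ x), ?_, ?_, ?_⟩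
    · ext <;> simp [h1, k1]
    · intro x hx
      have e := one_sub_moved_prodCongr (φ x) (ψ x)
      have a1 := moved_nonneg (φ x)
      have a2 := moved_nonneg (ψ x)
      have a3 := moved_le_one (φ x)
      have a4 := moved_le_one (ψ x)
      rcases Finset.mem_insert.1 hx with rfl | hx
      · have := k2 x (by simp)
        nlinarith
      · have := h2 x hx
        nlinarith
    · intro a b ha hb hab
      have e1 : Equiv.prodCongr (φ (a * b)) (ψ (a * b)) *
          (Equiv.prodCongr (φ a) (ψ a) * Equiv.prodCongr (φ b) (ψ b))⁻¹ =
          Equiv.prodCongr (φ (a * b) * (φ a * φ b)⁻¹) (ψ (a * b) * (ψ a * ψ b)⁻¹) := by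
        rw [mul_inv_eq_iff_eq_mul]
        ext <;> simp
      have e := one_sub_moved_prodCongr (φ (a * b) * (φ a * φ b)⁻¹) (ψ (a * b) * (ψ a * ψ b)⁻¹)
      have b1 := h3 a b ha hb hab
      have b2 := k3 a b ha hb hab
      have a1 := moved_nonneg (φ (a * b) * (φ a * φ b)⁻¹)
      have a2 := moved_nonneg (ψ (a * b) * (ψ a * ψ b)⁻¹)
      rw [e1]
      nlinarith [mul_nonneg a1 a2]

/-- Amplification: if the defects of `φ` are small in comparison with the length of `φ g`, then
the diagonal action on a power of the underlying set, with exponent about the reciprocal of that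
length, moves at least half of the points for `g`, and the defects remain small. -/
lemma HasAlmostHom.of_moved_lt {Φ : Finset G} {g : G} {ε : ℝ} {α : Type} [Fintype α]
    [DecidableEq α] [Nonempty α] {φ : G → Perm α} (h1 : φ 1 = 1) (hpos : 0 < moved (φ g))
    (h : ∀ a b, a ∈ Φ → b ∈ Φ → a * b ∈ Φ →
      2 * moved (φ (a * b) * (φ a * φ b)⁻¹) < ε * moved (φ g)) :
    HasAlmostHom Φ ε {g} := by
  set δ := moved (φ g) with hδ
  have hδ1 : δ ≤ 1 := moved_le_one _
  set k := ⌈1 / δ⌉₊ with hk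
  have hk1 : 1 ≤ k * δ := by
    have := Nat.le_ceil (1 / δ)
    rwa [div_le_iff₀ hpos] at this
  have hk2 : k * δ ≤ 2 := by
    have := (Nat.ceil_lt_add_one (one_div_nonneg.2 hpos.le)).le
    rw [← hk] at this
    calc k * δ ≤ (1 / δ + 1) * δ := by gcongr
      _ = 1 + δ := by field_simp
      _ ≤ 2 := by linarith
  refine ⟨Fin k → α, inferInstance, inferInstance, inferInstance,
    fun x => Equiv.piCongrRight fun _ => φ x, ?_, ?_, ?_⟩
  · ext
    simp [h1]
  · intro x hx
    rw [Finset.mem_singleton.1 hx]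
    have e := one_sub_moved_piCongrRight k (φ g)
    rw [← hδ] at e
    have b1 : 1 + k * δ ≤ (1 + δ) ^ k := one_add_mul_le_pow (by linarith) k
    have b2 : (1 - δ) ^ k * (1 + δ) ^ k ≤ 1 := by
      rw [← mul_pow]
      exact pow_le_one₀ (by nlinarith) (by nlinarith)
    have b3 : 0 ≤ (1 - δ) ^ k := pow_nonneg (by linarith) k
    nlinarith
  · intro a b ha hb hab
    have e1 : (Equiv.piCongrRight fun _ : Fin k => φ (a * b)) *
        ((Equiv.piCongrRight fun _ : Fin k => φ a) * (Equiv.piCongrRight fun _ : Fin k => φ b))⁻¹ =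
        Equiv.piCongrRight fun _ : Fin k => φ (a * b) * (φ a * φ b)⁻¹ := by
      rw [mul_inv_eq_iff_eq_mul]
      ext
      simp
    have e := one_sub_moved_piCongrRight k (φ (a * b) * (φ a * φ b)⁻¹)
    have hd := h a b ha hb hab
    rw [e1]
    set η := moved (φ (a * b) * (φ a * φ b)⁻¹)
    have a1 : 0 ≤ η := moved_nonneg _
    have a2 : η ≤ 1 := moved_le_one _
    have b1 : 1 + k * (-η) ≤ (1 + (-η)) ^ k := one_add_mul_le_pow (by linarith) k
    have b2 : k * η < ε := by
      have : 0 < ε := by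
        by_contra hneg
        nlinarith
      have h5 : k * (2 * η) < k * (ε * δ) :=
        mul_lt_mul_of_pos_left hd (by by_contra hneg; nlinarith)
      nlinarith
    rw [← sub_eq_add_neg, ← e] at b1
    linarith

/-- An exact local homomorphism to a finite group, acting on itself by translation. -/
lemma HasAlmostHom.of_finite {Φ : Finset G} {g : G} {F : Type} [Group F] [Finite F] {ψ : G → F}
    (h1 : (1 : G) ∈ Φ) (hg : ψ g ≠ 1)
    (h : ∀ a b, a ∈ Φ → b ∈ Φ → a * b ∈ Φ → ψ (a * b) = ψ a * ψ b) {ε : ℝ} (hε : 0 < ε) :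
    HasAlmostHom Φ ε {g} := by
  classical
  have := Fintype.ofFinite F
  refine ⟨F, inferInstance, inferInstance, inferInstance, fun x => MulAction.toPermHom F F (ψ x),
    ?_, ?_, ?_⟩
  · have := h 1 1 h1 h1 (by simpa using h1)
    rw [one_mul, left_eq_mul] at this
    simp only [this, map_one]
  · intro x hx
    rw [Finset.mem_singleton.1 hx]
    have e := one_sub_moved (MulAction.toPermHom F F (ψ g))
    have : (Finset.univ.filter fun x => MulAction.toPermHom F F (ψ g) x = x) = ∅ := by
      ext y
      simp [hg]
    rw [this] at e
    simp only [Finset.card_empty, Nat.cast_zero, zero_div] at e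
    linarith
  · intro a b ha hb hab
    simpa only [h a b ha hb hab, ← map_mul, mul_inv_cancel, moved_one] using hε

/-- For soficity it is enough to find almost homomorphisms that separate one element at a time; the
lower bound `1 / 2` then serves for the lengths of all elements `g ≠ 1`. -/
lemma isSofic_of_hasAlmostHom
    (h : ∀ (Φ : Finset G), (1 : G) ∈ Φ → ∀ g, g ≠ 1 → g ∈ Φ → ∀ ε : ℝ, 0 < ε →
      HasAlmostHom Φ ε {g}) : IsSofic G := by
  classical
  refine ⟨fun g => if g = 1 then 0 else 1 / 2, by simp, fun g hg => by simp [hg], ?_⟩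
  intro Φ ε hε
  obtain ⟨α, _, _, _, φ, h1, h2, h3⟩ := HasAlmostHom.of_forall_singleton (Φ := insert 1 Φ)
    (T := Φ.erase 1) (fun g hg => h _ (Finset.mem_insert_self 1 Φ) g (Finset.ne_of_mem_erase hg)
      (Finset.mem_insert_of_mem (Finset.mem_of_mem_erase hg))) hε
  let e := Fintype.equivFin α
  have hmoved : ∀ σ : Perm α, moved (e.permCongr σ) = moved σ := fun σ =>
    (moved_of_fixed_iff e fun x => by simp [Equiv.permCongr_apply]).symm
  have hmul : ∀ σ τ : Perm α, e.permCongr (σ * τ) = e.permCongr σ * e.permCongr τ := fun σ τ =>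
    map_mul e.permCongrHom σ τ
  have hinv : ∀ σ : Perm α, e.permCongr σ⁻¹ = (e.permCongr σ)⁻¹ := fun σ =>
    map_inv e.permCongrHom σ
  refine ⟨Perm (Fin (Fintype.card α)), inferInstance, fun g => e.permCongr (φ g),
    hamming _, ⟨_, Fintype.card_pos, ⟨MulEquiv.refl _⟩⟩,
    Or.inl ⟨_, Fintype.card_pos, MulEquiv.refl _, fun _ => rfl⟩, ?_, ?_, ?_⟩
  · simp only [h1]
    exact map_one e.permCongrHom
  · intro g hg
    rw [hamming_len_eq_moved, hmoved]
    dsimp only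
    split_ifs with hg1
    · exact moved_nonneg _
    · exact h2 g (Finset.mem_erase.2 ⟨hg1, hg⟩)
  · intro g k hg hk hgk
    rw [hamming_len_eq_moved, ← hmul, ← hinv, ← hmul, hmoved]
    exact h3 g k (Finset.mem_insert_of_mem hg) (Finset.mem_insert_of_mem hk)
      (Finset.mem_insert_of_mem hgk)

end AlmostHom

/-! ### Sofic groups are approximable -/

section SoficApproximable

open Equiv Equiv.Perm

lemma moved_le_of_mem_consequences {α : Type*} [Fintype α] [DecidableEq α] {X : Set (Perm α)}
    {ε : ℝ} (hX : ∀ x ∈ X, moved x ≤ ε) {n : ℕ} {y : Perm α} (hy : y ∈ consequences n X) :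
    moved y ≤ n * ε := by
  obtain ⟨x, g, hx, rfl⟩ := hy
  have h1 : ∀ i, moved ((g i)⁻¹ * x i * g i) ≤ ε := by
    intro i
    rw [moved_conj]
    rcases hx i with h | h
    · exact hX _ h
    · rw [← moved_inv]
      exact hX _ h
  have h2 : ∀ l : List (Perm α), (∀ σ ∈ l, moved σ ≤ ε) → moved l.prod ≤ l.length * ε := by
    intro l
    induction l with
    | nil => simp [moved_one]
    | cons a l ih =>
      intro h
      rw [List.prod_cons, List.length_cons]
      have := moved_mul_le a l.prod
      have := h a (by simp)
      have := ih fun σ hσ => h σ (List.mem_cons_of_mem a hσ)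
      push_cast
      linarith
  have h3 := h2 (List.ofFn fun i => (g i)⁻¹ * x i * g i) (by
    intro σ hσ
    obtain ⟨i, rfl⟩ := (List.mem_ofFn' _ _).1 hσ
    exact h1 i)
  rwa [List.length_ofFn] at h3

lemma map_mem_consequences {H H' : Type*} [Group H] [Group H'] (L : H →* H') {X : Set H}
    {X' : Set H'} (hX : ∀ x ∈ X, L x ∈ X') {n : ℕ} {y : H} (hy : y ∈ consequences n X) :
    L y ∈ consequences n X' := by
  obtain ⟨x, g, hx, rfl⟩ := hy
  refine ⟨fun i => L (x i), fun i => L (g i), fun i => ?_, ?_⟩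
  · rcases hx i with h | h
    · exact Or.inl (hX _ h)
    · exact Or.inr (by rw [← map_inv]; exact hX _ h)
  · rw [map_list_prod, List.map_ofFn]
    congr 2
    funext i
    simp

/-- Sofic groups are approximable by every class that receives all finite symmetric groups in a
way compatible with the Hamming length. -/
lemma IsSofic.isApproximable {G : Type u} [Group G] (hG : IsSofic G) {K : GroupClass.{0}}
    (hK : ∀ m : ℕ, 0 < m → ∃ (H : Type) (_ : Group H) (β : Type) (_ : Fintype β)
      (_ : DecidableEq β) (ι : Perm (Fin m) →* H) (L : H →* Perm β),
      K H ∧ ∀ σ, moved (L (ι σ)) = moved σ) : IsApproximable K G := by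
  classical
  intro Φ n
  obtain ⟨α, -, hα, h⟩ := hG
  obtain ⟨δ, hδ, hδα⟩ : ∃ δ > 0, ∀ g ∈ Φ.erase 1, δ ≤ α g := by
    rcases (Φ.erase 1).eq_empty_or_nonempty with h0 | h0
    · exact ⟨1, one_pos, by simp [h0]⟩
    · obtain ⟨g, hg, hmin⟩ := Finset.exists_min_image _ α h0
      exact ⟨α g, hα g (Finset.ne_of_mem_erase hg), hmin⟩
  obtain ⟨H₀, _, φ, l, -, hl, h1, h2, h3⟩ := h Φ (δ / (n + 1)) (by positivity)
  obtain ⟨m, hm, E, hE⟩ : ∃ m : ℕ, 0 < m ∧ ∃ E : H₀ →* Perm (Fin m),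
      ∀ x, l.len x = moved (E x) := by
    rcases hl with ⟨m, hm, e, he⟩ | ⟨m, hm, e, he⟩
    · exact ⟨m, hm, e.toMonoidHom, fun x => by rw [he, hamming_len_eq_moved]; rfl⟩
    · exact ⟨m, hm, (alternatingGroup (Fin m)).subtype.comp e.toMonoidHom,
        fun x => by rw [he, hamming_len_eq_moved]; rfl⟩
  obtain ⟨H, _, β, _, _, ι, L, hKH, hιL⟩ := hK m hm
  refine ⟨H, inferInstance, fun g => ι (E (φ g)), hKH, by simp [h1], ?_⟩
  rw [IsSeparatedFrom, Set.eq_empty_iff_forall_notMem]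
  rintro _ ⟨⟨g, ⟨hg, hg1⟩, rfl⟩, hcon⟩
  have hmap := map_mem_consequences L (X' := {σ | moved σ ≤ δ / (n + 1)}) (by
    rintro _ ⟨a, b, ha, hb, hab, rfl⟩
    have h4 := (h3 a b ha hb hab).le
    rw [hE, ← hιL, ← moved_inv] at h4
    have e : L (ι (E (φ a)) * ι (E (φ b)) * (ι (E (φ (a * b))))⁻¹) =
        (L (ι (E (φ (a * b) * (φ a * φ b)⁻¹))))⁻¹ := by
      simp [mul_assoc]
    rw [← e] at h4
    exact h4) hcon
  have h5 := moved_le_of_mem_consequences (fun _ hx => hx) hmap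
  rw [hιL, ← hE] at h5
  have h6 := h2 g hg
  have h7 := hδα g (Finset.mem_erase.2 ⟨hg1, hg⟩)
  have h8 : n * (δ / (n + 1)) < δ := by
    rw [mul_div_assoc', div_lt_iff₀ (by positivity)]
    nlinarith
  linarith

lemma IsSofic.isApproximable_symClass {G : Type u} [Group G] (hG : IsSofic G) :
    IsApproximable symClass G :=
  hG.isApproximable fun m hm => ⟨Perm (Fin m), inferInstance, Fin m, inferInstance, inferInstance,
    MonoidHom.id _, MonoidHom.id _, ⟨m, hm, ⟨MulEquiv.refl _⟩⟩, fun _ => rfl⟩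

/-- The symmetric group embeds into an alternating group of twice the degree by acting on two
copies of the set; this preserves the normalized Hamming length. -/
lemma IsSofic.isApproximable_altClass {G : Type u} [Group G] (hG : IsSofic G) :
    IsApproximable altClass G := by
  refine hG.isApproximable fun m hm => ?_
  have : Nonempty (Fin m) := ⟨⟨0, hm⟩⟩
  let ι : Perm (Fin m) →* alternatingGroup (Fin m ⊕ Fin m) :=
    ((sumCongrHom (Fin m) (Fin m)).comp ((MonoidHom.id _).prod (MonoidHom.id _))).codRestrict _
      fun σ => by
        rw [mem_alternatingGroup]
        change sign (Equiv.sumCongr σ σ) = 1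
        rw [sign_sumCongr, Int.units_mul_self]
  refine ⟨alternatingGroup (Fin m ⊕ Fin m), inferInstance, Fin m ⊕ Fin m, inferInstance,
    inferInstance, ι, (alternatingGroup _).subtype, ⟨m + m, by omega, ⟨?_⟩⟩, fun σ => ?_⟩
  · exact Equiv.altCongrHom finSumFinEquiv
  · exact moved_sumCongr σ

end SoficApproximable

/-! ### Consequences as powers of a set -/

section Consequences

open scoped Pointwise

/-- The set of all conjugates of elements of `X` and of their inverses. -/
def conjSet {H : Type v} [Group H] (X : Set H) : Set H :=
  {y | ∃ x g : H, (x ∈ X ∨ x⁻¹ ∈ X) ∧ y = g⁻¹ * x * g}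

lemma consequences_eq_pow {H : Type v} [Group H] (n : ℕ) (X : Set H) :
    consequences n X = conjSet X ^ n := by
  ext y
  rw [Set.mem_pow]
  constructor
  · rintro ⟨x, g, hx, rfl⟩
    exact ⟨fun i => ⟨(g i)⁻¹ * x i * g i, x i, g i, hx i, rfl⟩, rfl⟩
  · rintro ⟨f, rfl⟩
    choose x g hx hf using fun i => (f i).2
    exact ⟨x, g, hx, by simp only [hf]⟩

lemma exists_mem_consequences_of_mem_normalClosure {H : Type v} [Group H] {X : Set H} {y : H}
    (hy : y ∈ Subgroup.normalClosure X) : ∃ n, y ∈ consequences n X := by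
  simp only [consequences_eq_pow]
  induction hy using Subgroup.closure_induction with
  | mem y hy =>
    obtain ⟨x, hx, hxy⟩ := Group.mem_conjugatesOfSet_iff.1 hy
    obtain ⟨g, rfl⟩ := isConj_iff.1 hxy
    exact ⟨1, by rw [pow_one]; exact ⟨x, g⁻¹, Or.inl hx, by group⟩⟩
  | one => exact ⟨0, by simp⟩
  | mul a b _ _ ha hb =>
    obtain ⟨m, hm⟩ := ha
    obtain ⟨n, hn⟩ := hb
    exact ⟨m + n, by rw [pow_add]; exact Set.mul_mem_mul hm hn⟩
  | inv a _ ha =>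
    obtain ⟨n, hn⟩ := ha
    have h1 : (conjSet X)⁻¹ = conjSet X := by
      ext y
      rw [Set.mem_inv]
      constructor
      · rintro ⟨x, g, hx, e⟩
        exact ⟨x⁻¹, g, by rwa [inv_inv, or_comm], by rw [← inv_inv y, e]; group⟩
      · rintro ⟨x, g, hx, e⟩
        exact ⟨x⁻¹, g, by rwa [inv_inv, or_comm], by rw [e]; group⟩
    exact ⟨n, by rwa [← h1, inv_pow, Set.inv_mem_inv]⟩

lemma conjDiff_pow_subset_consequences {H : Type v} [Group H] {A : Subgroup H} {x : H} {X : Set H}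
    (hx : x ∈ X) (N : ℕ) : conjDiff A x ^ N ⊆ consequences (2 * N) X := by
  rw [consequences_eq_pow, pow_mul]
  refine Set.pow_subset_pow_left ?_
  rintro _ ⟨g, -, h, -, rfl⟩
  rw [pow_two]
  exact Set.mul_mem_mul ⟨x, g⁻¹, Or.inl hx, by group⟩
    ⟨x⁻¹, h⁻¹, Or.inr (by rwa [inv_inv]), by group⟩

lemma mem_conjDiff_pow_of_coe_mem {H : Type*} [Group H] {A K : Subgroup H} (hA : A ≤ K) {x z : K}
    {N : ℕ} (h : (z : H) ∈ conjDiff A (x : H) ^ N) : z ∈ conjDiff ⊤ x ^ N := by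
  induction N generalizing z with
  | zero =>
    rw [pow_zero, Set.mem_one] at h ⊢
    exact_mod_cast h
  | succ N ih =>
    rw [pow_succ, Set.mem_mul] at h ⊢
    obtain ⟨a, ha, _, ⟨g, hg, k, hk, rfl⟩, e⟩ := h
    let b : K := ⟨g, hA hg⟩ * x * ⟨g, hA hg⟩⁻¹ * (⟨k, hA hk⟩ * x * ⟨k, hA hk⟩⁻¹)⁻¹
    have hb : (z * b⁻¹ : K) = a := by
      rw [Subgroup.coe_mul, Subgroup.coe_inv, ← e]
      exact mul_inv_cancel_right _ _
    exact ⟨z * b⁻¹, ih (by rwa [hb]), b, ⟨_, trivial, _, trivial, rfl⟩, by group⟩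

lemma mem_conjDiff_pow_pi {ι : Type*} {H : ι → Type*} [∀ i, Group (H i)] {x z : ∀ i, H i} {N : ℕ}
    (h : ∀ i, z i ∈ conjDiff ⊤ (x i) ^ N) : z ∈ conjDiff ⊤ x ^ N := by
  induction N generalizing z with
  | zero =>
    simp only [pow_zero, Set.mem_one] at h ⊢
    exact funext h
  | succ N ih =>
    simp only [pow_succ, Set.mem_mul] at h ⊢
    choose a ha b hb hab using h
    choose g _ k _ hb using hb
    exact ⟨a, ih ha, b, ⟨g, trivial, k, trivial, funext hb⟩, funext hab⟩

/-- In a direct product, let each component of `z` be a product of `N` quotients of conjugates of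
the same component of one of the elements `x t`, where `t` may depend on the component. Then `z`
is a consequence of bounded length of the elements `x t`: one block is provided for each `t`, and
it is trivial in the components that do not use `t`. -/
lemma mem_consequences_pi {ι : Type v} {H : ι → Type v} [∀ i, Group (H i)] {D : Type*}
    {x : D → ∀ i, H i} {X : Set (∀ i, H i)} {N : ℕ} {j : ι → D} (L : List D)
    (hX : ∀ t ∈ L, x t ∈ X) {z : ∀ i, H i} (h : ∀ i, z i ∈ conjDiff ⊤ (x (j i) i) ^ N)
    (hL : ∀ i, z i = 1 ∨ j i ∈ L) : z ∈ consequences (2 * N * L.length) X := by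
  classical
  induction L generalizing z with
  | nil =>
    have : z = 1 := funext fun i => by simpa using hL i
    simp [this, consequences_eq_pow]
  | cons t L ih =>
    have h1 : ∀ i (y : H i), 1 ∈ conjDiff ⊤ y ^ N := fun i y =>
      conjDiff_pow_mono _ _ (Nat.zero_le N) (by simp)
    have e : z = (fun i => if j i = t then z i else 1) * fun i => if j i = t then 1 else z i := by
      funext i
      by_cases hi : j i = t <;> simp [hi]
    rw [e, consequences_eq_pow, List.length_cons, mul_add, mul_one, add_comm, pow_add,
      ← consequences_eq_pow, ← consequences_eq_pow]
    refine Set.mul_mem_mul ?_ (ih (fun t ht => hX t (List.mem_cons_of_mem _ ht)) ?_ ?_)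
    · refine conjDiff_pow_subset_consequences (A := ⊤) (hX t (by simp)) N
        (mem_conjDiff_pow_pi fun i => ?_)
      split_ifs with hi
      · exact hi ▸ h i
      · exact h1 i _
    · intro i
      split_ifs with hi
      · exact h1 i _
      · exact h i
    · intro i
      split_ifs with hi
      · exact Or.inl rfl
      · simpa [hi] using hL i

end Consequences

/-! ### Local homomorphisms into groups of bounded order -/

section BoundedOrder

open Equiv

variable {G : Type u} [Group G]

/-- Let a finite set `Φ` and a bound on the orders of finite groups be given. Then either `g` is
detected by an exact local homomorphism of `Φ` to a finite group, or there is one expression which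
writes the image of `g` as a product of conjugates of defects (and their inverses) for all maps from
`Φ` to groups of bounded order. This holds because up to isomorphism there are only finitely many
such maps, so that they are all the components of a single map to a finite group `U`; the two cases
are whether or not the image of `g` in `U` lies in the normal closure of the defects. -/
lemma exists_local_hom_or_uniform_expression {Φ : Finset G} {g : G} (hg : g ∈ Φ) (B : ℕ) :
    (∃ (F : Type) (_ : Group F) (_ : Finite F) (ψ : G → F), ψ g ≠ 1 ∧
      ∀ a b, a ∈ Φ → b ∈ Φ → a * b ∈ Φ → ψ (a * b) = ψ a * ψ b) ∨
    ∃ (n : ℕ) (a b : Fin n → G) (s : Fin n → ℤ),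
      (∀ l, a l ∈ Φ ∧ b l ∈ Φ ∧ a l * b l ∈ Φ) ∧ (∀ l, s l = 1 ∨ s l = -1) ∧
      ∀ (H : Type) [Group H] [Finite H], Nat.card H ≤ B → ∀ ψ : G → H, ∃ c : Fin n → H,
        ψ g = (List.ofFn fun l =>
          (c l)⁻¹ * (ψ (a l) * ψ (b l) * (ψ (a l * b l))⁻¹) ^ s l * c l).prod := by
  classical
  let T : Type := Σ Q : Subgroup (Perm (Fin B)), (Fin Φ.card → Q)
  let U : Type := ∀ t : T, t.1
  let φ : G → U := fun x t => if h : x ∈ Φ then t.2 (Φ.equivFin ⟨x, h⟩) else 1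
  by_cases hmem : φ g ∈ Subgroup.normalClosure (defects (Φ : Set G) φ)
  · right
    obtain ⟨n, x, c, hx, hgx⟩ := exists_mem_consequences_of_mem_normalClosure hmem
    have hx' : ∀ l, ∃ (a b : G) (s : ℤ), (a ∈ Φ ∧ b ∈ Φ ∧ a * b ∈ Φ) ∧ (s = 1 ∨ s = -1) ∧
        x l = (φ a * φ b * (φ (a * b))⁻¹) ^ s := by
      intro l
      rcases hx l with ⟨a, b, ha, hb, hab, e⟩ | ⟨a, b, ha, hb, hab, e⟩
      · exact ⟨a, b, 1, ⟨ha, hb, hab⟩, Or.inl rfl, by rw [e, zpow_one]⟩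
      · exact ⟨a, b, -1, ⟨ha, hb, hab⟩, Or.inr rfl, by rw [← e, zpow_neg_one, inv_inv]⟩
    choose a b s hab hs hxs using hx'
    refine ⟨n, a, b, s, hab, hs, fun H _ _ hB ψ => ?_⟩
    have hcard : Nat.card H ≤ Nat.card (Fin B) := by simpa using hB
    obtain ⟨f⟩ : Nonempty (H ↪ Fin B) := by
      have := Fintype.ofFinite H
      exact Function.Embedding.nonempty_of_card_le (by
        simpa only [Nat.card_eq_fintype_card] using hcard)
    have hinj : Function.Injective ((Perm.viaEmbeddingHom f).comp (MulAction.toPermHom H H)) :=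
      (Perm.viaEmbeddingHom_injective f).comp MulAction.toPerm_injective
    let e := MonoidHom.ofInjective hinj
    let t : T := ⟨_, fun i => e (ψ (Φ.equivFin.symm i))⟩
    let p : U →* H := e.symm.toMonoidHom.comp (Pi.evalMonoidHom (fun t : T => t.1) t)
    have hp : ∀ x ∈ Φ, p (φ x) = ψ x := by
      intro x hx
      have h1 : φ x t = e (ψ x) := by
        simp only [φ, hx, t, dif_pos, Equiv.symm_apply_apply]
      change e.symm (φ x t) = ψ x
      rw [h1, MulEquiv.symm_apply_apply]
    refine ⟨fun l => p (c l), ?_⟩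
    rw [← hp g hg, hgx, map_list_prod, List.map_ofFn]
    congr 2
    funext l
    have hpx : p (x l) = (ψ (a l) * ψ (b l) * (ψ (a l * b l))⁻¹) ^ s l := by
      rw [hxs]
      refine (map_zpow p _ _).trans ?_
      rw [map_mul, map_mul, map_inv, hp _ (hab l).1, hp _ (hab l).2.1, hp _ (hab l).2.2]
    simp only [Function.comp_apply, map_mul, map_inv, hpx]
  · left
    refine ⟨U ⧸ Subgroup.normalClosure (defects (Φ : Set G) φ), inferInstance, inferInstance,
      fun x => (φ x : U ⧸ _), fun h => hmem ((QuotientGroup.eq_one_iff _).1 h), ?_⟩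
    intro a b ha hb hab
    have h1 : φ a * φ b * (φ (a * b))⁻¹ ∈ Subgroup.normalClosure (defects (Φ : Set G) φ) :=
      Subgroup.subset_normalClosure ⟨a, b, ha, hb, hab, rfl⟩
    have h2 : ((φ a * φ b * (φ (a * b))⁻¹ : U) :
        U ⧸ Subgroup.normalClosure (defects (Φ : Set G) φ)) = 1 := (QuotientGroup.eq_one_iff _).2 h1
    rw [QuotientGroup.mk_mul, QuotientGroup.mk_mul, QuotientGroup.mk_inv, mul_inv_eq_one] at h2
    exact h2.symm

end BoundedOrder

/-! ### Groups approximable by products of permutation groups are sofic -/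

section Products

open scoped Pointwise
open Equiv Equiv.Perm

variable {G : Type u} [Group G]

/-- The class of finite direct products of finite symmetric or alternating groups, up to
isomorphism: the factors are the permutation groups that contain the alternating group. -/
def productClass : GroupClass.{0} := fun P _ =>
  ∃ (k : ℕ) (m : Fin k → ℕ) (K : ∀ i, Subgroup (Perm (Fin (m i)))),
    (∀ i, alternatingGroup (Fin (m i)) ≤ K i) ∧ Nonempty (P ≃* ∀ i, K i)

lemma mem_conjDiff_pow_of_moved_le {m : ℕ} (hm : 15 ≤ m) (k : ℕ) {x z : Perm (Fin m)}
    (hz : sign z = 1) (hk : moved z ≤ k * moved x) :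
    z ∈ conjDiff (alternatingGroup (Fin m)) x ^ (48 * k + 12) := by
  refine mem_conjDiff_pow_of_card_support_le (by simpa using hm) k hz ?_
  have hm0 : (0 : ℝ) < Fintype.card (Fin m) := by
    rw [Fintype.card_fin]
    exact_mod_cast (by omega : 0 < m)
  rw [moved, moved, mul_div_assoc', div_le_div_iff_of_pos_right hm0] at hk
  exact_mod_cast hk

/-- In a product of permutation groups, let `c` be a consequence of `X` that agrees with `y` in the
factors of small degree and has the same signs as `y` in the others, and suppose that in each of
these one of the elements `x t` moves at least a fixed proportion of the number of points moved by
`y` and at least as many points as any element of `X`. Then `y * c⁻¹`, hence also `y`, is a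
consequence of `X`, of a length that does not depend on the number of factors. -/
lemma mem_consequences_of_moved_le {ι : Type} {m : ι → ℕ} {K : ∀ i, Subgroup (Perm (Fin (m i)))}
    (hK : ∀ i, alternatingGroup (Fin (m i)) ≤ K i) {D : Type*} {x : D → ∀ i, K i}
    {X : Set (∀ i, K i)} {L : List D} (hL : ∀ t ∈ L, x t ∈ X) {j : ι → D} (hj : ∀ i, j i ∈ L)
    (hX : ∀ i, ∀ y ∈ X, moved (y i : Perm (Fin (m i))) ≤ moved (x (j i) i : Perm (Fin (m i))))
    {y c : ∀ i, K i} {n k : ℕ} (hc : c ∈ consequences n X)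
    (hsmall : ∀ i, m i < 15 → y i = c i)
    (hsign : ∀ i, 15 ≤ m i → sign (y i : Perm (Fin (m i))) = sign (c i : Perm (Fin (m i))))
    (hy : ∀ i, 15 ≤ m i →
      moved (y i : Perm (Fin (m i))) ≤ k * moved (x (j i) i : Perm (Fin (m i)))) :
    y ∈ consequences (2 * (48 * (k + n) + 12) * L.length + n) X := by
  have hz : ∀ i, (y * c⁻¹) i ∈ conjDiff ⊤ (x (j i) i) ^ (48 * (k + n) + 12) := by
    intro i
    by_cases hi : m i < 15
    · have h1 : (y * c⁻¹) i = 1 := by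
        rw [Pi.mul_apply, Pi.inv_apply, hsmall i hi, mul_inv_cancel]
      rw [h1]
      exact conjDiff_pow_mono _ _ (Nat.zero_le _) (by simp)
    rw [not_lt] at hi
    have hcm : moved (c i : Perm (Fin (m i))) ≤ n * moved (x (j i) i : Perm (Fin (m i))) :=
      moved_le_of_mem_consequences
        (X := {σ | moved σ ≤ moved (x (j i) i : Perm (Fin (m i)))}) (fun _ h => h)
        (map_mem_consequences ((K i).subtype.comp (Pi.evalMonoidHom (fun i => K i) i)) (hX i) hc)
    refine mem_conjDiff_pow_of_coe_mem (hK i) (mem_conjDiff_pow_of_moved_le hi (k + n) ?_ ?_)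
    · simp [hsign i hi]
    · have h1 := moved_mul_le (y i : Perm (Fin (m i))) (c i : Perm (Fin (m i)))⁻¹
      rw [moved_inv] at h1
      have h2 := hy i hi
      refine h1.trans ?_
      push_cast
      linarith
  have hzmem := mem_consequences_pi (X := X) (x := x) L hL hz fun i => Or.inr (hj i)
  rw [consequences_eq_pow] at hzmem hc ⊢
  rw [pow_add, ← inv_mul_cancel_right y c]
  exact Set.mul_mem_mul hzmem hc

lemma exists_factorial_le (k : ℕ) : ∃ B : ℕ, 2 ≤ B ∧ ∀ m < k, m.factorial ≤ B :=
  ⟨(k + 2).factorial, (Nat.le_add_left 2 k).trans (Nat.self_le_factorial _),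
    fun _ hm => Nat.factorial_le (by omega)⟩

/-- Groups approximable by finite products of symmetric and alternating groups are sofic: in one of
the factors all defects are short in comparison with the image of `g`, since otherwise that image
would be a consequence of the defects. -/
theorem IsApproximable.isSofic_of_productClass (hG : IsApproximable productClass G) :
    IsSofic G := by
  classical
  refine isSofic_of_hasAlmostHom fun Φ hΦ g hg1 hg ε hε => ?_
  obtain ⟨B, hB2, hB⟩ := exists_factorial_le 15
  rcases exists_local_hom_or_uniform_expression hg B with
    ⟨F, _, _, ψ, hψg, hψ⟩ | ⟨n₀, a, b, s, hab, hs, hW⟩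
  · exact HasAlmostHom.of_finite hΦ hψg hψ hε
  obtain ⟨k₀, hk₀⟩ := exists_nat_gt (2 / ε)
  rw [div_lt_iff₀ hε] at hk₀
  set D := (Φ ×ˢ Φ).filter fun t => t.1 * t.2 ∈ Φ with hD
  have hDmem : ∀ a b, a ∈ Φ → b ∈ Φ → a * b ∈ Φ → (a, b) ∈ D := fun a b ha hb hab => by
    simp [hD, ha, hb, hab]
  obtain ⟨P, _, φ', ⟨k, m, K, hK, ⟨e⟩⟩, hφ1, hsep⟩ := hG Φ
    (2 * (48 * (k₀ + n₀) + 12) * D.toList.length + n₀)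
  let φ : G → ∀ i, K i := fun x => e (φ' x)
  let d : G × G → ∀ i, K i := fun t => φ t.1 * φ t.2 * (φ (t.1 * t.2))⁻¹
  have hd : ∀ t ∈ D, d t ∈ defects (Φ : Set G) φ := fun t ht => by
    simp only [hD, Finset.mem_filter, Finset.mem_product] at ht
    exact ⟨t.1, t.2, ht.1.1, ht.1.2, ht.2, rfl⟩
  -- In each factor, the defect that moves most points.
  have hDne : D.Nonempty := ⟨(1, 1), hDmem 1 1 hΦ hΦ (by rwa [one_mul])⟩
  have hmax : ∀ i, ∃ t ∈ D, ∀ t' ∈ D,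
      moved (d t' i : Perm (Fin (m i))) ≤ moved (d t i : Perm (Fin (m i))) :=
    fun i => Finset.exists_max_image D (fun t => moved (d t i : Perm (Fin (m i)))) hDne
  choose j hjD hj using hmax
  by_cases hcase : ∃ i, 15 ≤ m i ∧
      k₀ * moved (d (j i) i : Perm (Fin (m i))) < moved (φ g i : Perm (Fin (m i)))
  · obtain ⟨i, hi, hlt⟩ := hcase
    have : Nonempty (Fin (m i)) := ⟨⟨0, by omega⟩⟩
    refine HasAlmostHom.of_moved_lt (φ := fun x => (φ x i : Perm (Fin (m i)))) ?_ ?_ ?_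
    · simp [φ, hφ1]
    · exact lt_of_le_of_lt (mul_nonneg (Nat.cast_nonneg _) (moved_nonneg _)) hlt
    · intro a b ha hb hab
      have h1 := hj i _ (hDmem a b ha hb hab)
      have h2 : moved ((φ (a * b) i : Perm (Fin (m i))) * (φ a i * φ b i : Perm (Fin (m i)))⁻¹) =
          moved (d (a, b) i : Perm (Fin (m i))) := by
        rw [← moved_inv]
        simp [d, mul_assoc]
      rw [h2]
      have h3 := moved_nonneg (d (j i) i : Perm (Fin (m i)))
      nlinarith
  -- Otherwise `φ g` is a product of few conjugates of defects, contrary to separation.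
  exfalso
  push Not at hcase
  have hc : ∀ i, ∃ c : Fin n₀ → K i,
      (m i < 15 → φ g i = (List.ofFn fun l =>
        (c l)⁻¹ * (φ (a l) i * φ (b l) i * (φ (a l * b l) i)⁻¹) ^ s l * c l).prod) ∧
      (15 ≤ m i → c = 1) := by
    intro i
    by_cases hi : m i < 15
    · obtain ⟨c, hc⟩ := hW (K i) ((Subgroup.card_le_card_group _).trans (by
        rw [Nat.card_perm, Nat.card_fin]
        exact hB _ hi)) fun x => φ x i
      exact ⟨c, fun _ => hc, fun h => by omega⟩
    · exact ⟨1, fun h => absurd h hi, fun _ => rfl⟩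
  choose c' hc'1 hc'2 using hc
  set c : ∀ i, K i := (List.ofFn fun l => (fun i => c' i l)⁻¹ *
    (φ (a l) * φ (b l) * (φ (a l * b l))⁻¹) ^ s l * fun i => c' i l).prod with hcdef
  have hcmem : c ∈ consequences n₀ (defects (Φ : Set G) φ) := by
    refine ⟨_, fun l i => c' i l, fun l => ?_, hcdef⟩
    have : φ (a l) * φ (b l) * (φ (a l * b l))⁻¹ ∈ defects (Φ : Set G) φ :=
      ⟨a l, b l, (hab l).1, (hab l).2.1, (hab l).2.2, rfl⟩
    rcases hs l with h | h
    · exact Or.inl (by rwa [h, zpow_one])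
    · exact Or.inr (by rwa [h, zpow_neg_one, inv_inv])
  have hci : ∀ i, c i = (List.ofFn fun l =>
      (c' i l)⁻¹ * (φ (a l) i * φ (b l) i * (φ (a l * b l) i)⁻¹) ^ s l * c' i l).prod := by
    intro i
    change Pi.evalMonoidHom (fun i => K i) i c = _
    rw [hcdef, map_list_prod, List.map_ofFn]
    rfl
  have hsign : ∀ i, 15 ≤ m i →
      sign (φ g i : Perm (Fin (m i))) = sign (c i : Perm (Fin (m i))) := by
    intro i hi
    obtain ⟨w, hw⟩ := hW ℤˣ (by simpa using hB2) fun x => sign (φ x i : Perm (Fin (m i)))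
    rw [hw, hci, hc'2 i hi]
    change _ = (sign.comp (K i).subtype) _
    rw [map_list_prod, List.map_ofFn]
    congr 2
    funext l
    simp only [Function.comp_apply, Pi.one_apply, inv_one, one_mul, mul_one, map_zpow, map_mul,
      map_inv, MonoidHom.comp_apply, Subgroup.subtype_apply]
    rw [mul_comm, mul_inv_cancel_left]
  have hjX : ∀ i, ∀ y ∈ defects (Φ : Set G) φ,
      moved (y i : Perm (Fin (m i))) ≤ moved (d (j i) i : Perm (Fin (m i))) := by
    rintro i _ ⟨a, b, ha, hb, hab, rfl⟩
    exact hj i (a, b) (hDmem a b ha hb hab)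
  have hsmall : ∀ i, m i < 15 → φ g i = c i := fun i hi => (hc'1 i hi).trans (hci i).symm
  have hfin := mem_consequences_of_moved_le (x := d) (X := defects (Φ : Set G) φ) (L := D.toList)
    (j := j) (y := φ g) (c := c) (n := n₀) (k := k₀) hK
    (fun t ht => hd t (Finset.mem_toList.1 ht)) (fun i => Finset.mem_toList.2 (hjD i))
    hjX hcmem hsmall hsign hcase
  have hback := map_mem_consequences e.symm.toMonoidHom (X' := defects (Φ : Set G) φ') (by
    rintro _ ⟨a, b, ha, hb, hab, rfl⟩
    exact ⟨a, b, ha, hb, hab, by simp [φ]⟩) hfin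
  have h1 : e.symm.toMonoidHom (φ g) = φ' g := e.symm_apply_apply _
  rw [h1] at hback
  exact Set.eq_empty_iff_forall_notMem.1 hsep _ ⟨⟨g, ⟨hg, hg1⟩, rfl⟩, hback⟩

end Products

/-! ### The equivalences -/

section Equivalences

open Equiv Equiv.Perm

variable {G : Type u} [Group G]

lemma IsApproximable.mono {K K' : GroupClass.{v}} (h : ∀ (H : Type v) [Group H], K H → K' H)
    (hG : IsApproximable K G) : IsApproximable K' G := by
  intro Φ n
  obtain ⟨H, _, φ, hK, h1, h2⟩ := hG Φ n
  exact ⟨H, _, φ, h H hK, h1, h2⟩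

lemma productClass_of_finiteProducts {K : GroupClass.{0}}
    (hK : ∀ (H : Type) [Group H], K H → ∃ (m : ℕ) (Q : Subgroup (Perm (Fin m))),
      alternatingGroup (Fin m) ≤ Q ∧ Nonempty (H ≃* Q))
    (P : Type) [Group P] (hP : finiteProducts K P) : productClass P := by
  rcases hP with hP | ⟨k, H, _, hH, ⟨e⟩⟩
  · obtain ⟨m, Q, hQ, ⟨e⟩⟩ := hK P hP
    exact ⟨1, fun _ => m, fun _ => Q, fun _ => hQ, ⟨e.trans (MulEquiv.funUnique (Fin 1) Q).symm⟩⟩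
  · choose m Q hQ hE using fun i => hK (H i) (hH i)
    exact ⟨k, m, Q, hQ, ⟨e.trans (MulEquiv.piCongrRight fun i => (hE i).some)⟩⟩

lemma isSofic_of_isApproximable_finiteProducts_symClass
    (hG : IsApproximable (finiteProducts symClass) G) : IsSofic G := by
  refine (hG.mono (productClass_of_finiteProducts ?_)).isSofic_of_productClass
  rintro H _ ⟨m, -, ⟨e⟩⟩
  exact ⟨m, ⊤, le_top, ⟨e.trans Subgroup.topEquiv.symm⟩⟩

lemma isSofic_of_isApproximable_finiteProducts_altClass
    (hG : IsApproximable (finiteProducts altClass) G) : IsSofic G := by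
  refine (hG.mono (productClass_of_finiteProducts ?_)).isSofic_of_productClass
  rintro H _ ⟨m, -, ⟨e⟩⟩
  exact ⟨m, alternatingGroup (Fin m), le_rfl, ⟨e⟩⟩

lemma IsApproximable.finiteProducts {K : GroupClass.{v}} (hG : IsApproximable K G) :
    IsApproximable (finiteProducts K) G :=
  hG.mono fun _ _ h => Or.inl h

end Equivalences

end Approx

theorem mainTheorem1 (G : Type u) [Group G] :
    (Approx.IsApproximable Approx.symClass G ↔ Approx.IsSofic G) ∧
    (Approx.IsApproximable (Approx.finiteProducts Approx.symClass) G ↔ Approx.IsSofic G) ∧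
    (Approx.IsApproximable Approx.altClass G ↔ Approx.IsSofic G) ∧
    (Approx.IsApproximable (Approx.finiteProducts Approx.altClass) G ↔ Approx.IsSofic G) := by
  refine ⟨⟨fun h => ?_, fun h => h.isApproximable_symClass⟩,
    ⟨fun h => ?_, fun h => h.isApproximable_symClass.finiteProducts⟩,
    ⟨fun h => ?_, fun h => h.isApproximable_altClass⟩,
    ⟨fun h => ?_, fun h => h.isApproximable_altClass.finiteProducts⟩⟩
  · exact Approx.isSofic_of_isApproximable_finiteProducts_symClass h.finiteProducts
  · exact Approx.isSofic_of_isApproximable_finiteProducts_symClass h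
  · exact Approx.isSofic_of_isApproximable_finiteProducts_altClass h.finiteProducts
  · exact Approx.isSofic_of_isApproximable_finiteProducts_altClass h
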